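/- The dimension monoid $\operatorname{Dim} L$ of a lattice $L$ is the commutative monoid defined by generators $\Delta(x,y)$, for $x\le y$ in $L$, and the relations $\Delta(x,x)=0$ for $x\in L$; $\Delta(x,z)=\Delta(x,y)+\Delta(y,z)$ for $x\le y\le z$ in $L$; and $\Delta(x\wedge y,x)=\Delta(y,x\vee y)$ for $x,y\in L$. A homomorphism $\mu\colon M\to N$ of commutative monoids is a V-homomorphism if, whenever $\mu(c)=a'+b'$ with $c\in M$ and $a',b'\in N$, there are $a,b\in M$ such that $c=a+b$, $\mu(a)=a'$ and $\mu(b)=b'$. A dimension group is a partially ordered abelian group $G$ that is directed ($G=G^++(-G^+)$), unperforated ($mx\ge 0$ implies $x\ge 0$, for every $x\in G$ and every integer $m\geq 1$) and satisfies interpolation (if $x,x'\le y,y'$ in $G$, then there is $z\in G$ with $x,x'\le z\le y,y'$). An element $e\in G^+$ is an order-unit if for every $x\in G$ there is a natural number $n$ with $x\le ne$; it has index at most $n$ if, for all $x\in G^+$, $(n+1)x\le e$ implies $x=0$, and its index is the least positive integer $n$ such that it has index at most $n$, if there is one. **Theorem.** For every cardinal $\kappa\ge\aleph_2$ there exists a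 dimension group $G$ of cardinality $\kappa$, with an order-unit of index $2$, such that for every lattice $L$, there is no surjective V-homomorphism from $\operatorname{Dim} L$ onto the positive cone $G^+$. In particular, $G^+\not\cong\operatorname{Dim} L$ for every lattice $L$. -/

import Mathlib

universe u v

namespace LatticeDim

/-- Formal generators `Δ(x, y)` of the dimension monoid: the pairs `x ≤ y` in `L`. -/
abbrev LePair (L : Type*) [LE L] : Type _ := {p : L × L // p.1 ≤ p.2}

/-- The formal generator `Δ(x, y)`, as an element of the free commutative monoid
on the set of pairs `x ≤ y` (the finite multisets of such pairs, under addition). -/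
def gen {L : Type*} [LE L] (x y : L) (h : x ≤ y) : Multiset (LePair L) :=
  {⟨(x, y), h⟩}

/-- The defining relations of the dimension monoid. -/
inductive DimRel (L : Type*) [Lattice L] :
    Multiset (LePair L) → Multiset (LePair L) → Prop
  | refl (x : L) : DimRel L (gen x x le_rfl) 0
  | add (x y z : L) (hxy : x ≤ y) (hyz : y ≤ z) :
      DimRel L (gen x z (hxy.trans hyz)) (gen x y hxy + gen y z hyz)
  | perspective (x y : L) :
      DimRel L (gen (x ⊓ y) x inf_le_left) (gen y (x ⊔ y) le_sup_right)

/-- The dimension monoid `Dim L` of a lattice `L`: the commutative monoid presented by the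
generators `Δ(x, y)`, for `x ≤ y` in `L`, and the relations `DimRel L`. -/
def Dim (L : Type*) [Lattice L] : Type _ := (addConGen (DimRel L)).Quotient

instance instAddCommMonoidDim (L : Type*) [Lattice L] : AddCommMonoid (Dim L) :=
  inferInstanceAs (AddCommMonoid (addConGen (DimRel L)).Quotient)

/-- A monoid homomorphism `μ : M → N` is a V-homomorphism if every decomposition
`μ c = a' + b'` in `N` lifts to a decomposition `c = a + b` in `M`. -/
def IsVHom {M N : Type*} [AddCommMonoid M] [AddCommMonoid N] (μ : M →+ N) : Prop :=
  ∀ (c : M) (a' b' : N), μ c = a' + b' → ∃ a b : M, c = a + b ∧ μ a = a' ∧ μ b = b'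

section PartiallyOrderedGroups

variable (G : Type*) [AddCommGroup G] [PartialOrder G]

/-- A dimension group: a directed, unperforated partially ordered abelian group
with the interpolation property. -/
structure IsDimensionGroup [IsOrderedAddMonoid G] : Prop where
  directed : ∀ x : G, ∃ a b : G, 0 ≤ a ∧ 0 ≤ b ∧ x = a + -b
  unperforated : ∀ (m : ℕ) (x : G), 0 < m → 0 ≤ m • x → 0 ≤ x
  interpolation : ∀ x x' y y' : G, x ≤ y → x ≤ y' → x' ≤ y → x' ≤ y' →
    ∃ z : G, x ≤ z ∧ x' ≤ z ∧ z ≤ y ∧ z ≤ y'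

variable {G}

/-- `e` is an order-unit of `G`. -/
def IsOrderUnit (e : G) : Prop :=
  0 ≤ e ∧ ∀ x : G, ∃ n : ℕ, x ≤ n • e

/-- `e` has index at most `n`. -/
def IndexAtMost (e : G) (n : ℕ) : Prop :=
  ∀ x : G, 0 ≤ x → (n + 1) • x ≤ e → x = 0

/-- `e` has index (exactly) `n`: `n` is the least positive integer such that `e` has index
at most `n`. -/
def HasIndex (e : G) (n : ℕ) : Prop :=
  IsLeast {m : ℕ | 0 < m ∧ IndexAtMost e m} n

end PartiallyOrderedGroups

end LatticeDim

/-!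
Let `Ω` have cardinality `κ ≥ ℵ₂`. The group `cubeGroup Ω` consists of pairs `(u, v)`, with `u` an
integer function on the finite subsets of `Ω` and `v` one on the triples, for which some finite
`F ⊆ Ω` satisfies `u A = u (A ∩ F)` and
`v (x, y, z) = u {x, y} + u {y, z} + u ∅ - u {y}` at all triples not contained in `F`. The formula
is such that, as soon as one of `x, y, z` is missing from `F`, it is a sum of two values of `u`
(`SupportedOn.exists_two`). Hence for each `F` the pairs supported on `F` form a simplicial group,
and `cubeGroup Ω` is a dimension group. The element `unit = (1, 2)` is an order-unit of index `2`.
The two values used at `(x, y, z)` are `u {x, y} + u ∅` when `z` is missing, `u {y, z} + u ∅` when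
`x` is missing, and `u {x} + u {z}` when `y` is missing; they are not consistent with each other,
since the first two would identify `x` with `y` and `y` with `z`, and the third separates `x`
from `z`.

Let `μ` be a surjective V-homomorphism from `Dim L` to the positive cone. It induces a group-valued
measure `f` on the intervals of `L`. Because a group is cancellative, `f` is modular
(`IsMeasure.inf_add_sup`), and therefore every decomposition in `Dim L` of a sum of intervals comes,
up to `f`, from subdividing these intervals by chains (`mem_splittings_of_mk_eq_add`). Write
`unit` as a sum of values of `f` at intervals and let `[s, t]` be the interval with
`f s t` equal to `1` at `∅`. The decompositions of `unit` into `indicator x` and its complement give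
elements `w x` of `[s, t]` such that `f s (w x)` has values `(0, 1)` or `(1, 0)` at `(∅, {x})`, for
all `x` outside a finite set (`Splitting.exists_separating`). One of the patterns occurs for `ℵ₂`
many `x`. The distance `f (w x ⊓ w y) (w x ⊔ w y)` has a finite support, so Kuratowski's free set
theorem (`exists_free_triple`) gives `x, y, z` such that each of them is missing from
the support attached to the other two. Evaluated at `(x, y, z)`, the distances from `w x` to `w y`
and from `w y` to `w z` are zero and the distance from `w x` to `w z` is not, which contradicts the
triangle inequality (`IsMeasure.dist_triangle`).
-/

namespace LatticeDim

/-! ### Measures on lattices and coloured subdivisions -/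

section Measures

variable {L A : Type*} [Lattice L] [AddCommGroup A]

/-- A group-valued measure on a lattice: a function on intervals that satisfies the defining
relations of the dimension monoid. Only the values `f x y` with `x ≤ y` are meaningful. -/
structure IsMeasure (f : L → L → A) : Prop where
  self : ∀ x, f x x = 0
  add : ∀ {x y z}, x ≤ y → y ≤ z → f x z = f x y + f y z
  perspective : ∀ x y, f (x ⊓ y) x = f y (x ⊔ y)

namespace IsMeasure

variable {f : L → L → A}

theorem map {B : Type*} [AddCommGroup B] (hf : IsMeasure f) (φ : A →+ B) :
    IsMeasure fun x y => φ (f x y) where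
  self x := by simp [hf.self]
  add h h' := by rw [hf.add h h', map_add]
  perspective x y := by rw [hf.perspective]

/-- Cancellation in the group makes measures modular: every interval decomposes into its projections
below and above a given element, even though the lattice itself need not be modular. -/
theorem inf_add_sup (hf : IsMeasure f) {s t : L} (hst : s ≤ t) (y : L) :
    f s t = f (s ⊓ y) (t ⊓ y) + f (s ⊔ y) (t ⊔ y) := by
  have h₁ := hf.add (inf_le_left : s ⊓ y ≤ s) hst
  have h₂ := hf.add (inf_le_inf_right y hst) (inf_le_left : t ⊓ y ≤ t)
  have h₃ := hf.add (le_sup_right : y ≤ s ⊔ y) (sup_le_sup_right hst y)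
  rw [hf.perspective] at h₁ h₂
  rw [h₂, h₃] at h₁
  have h : f y (s ⊔ y) + (f (s ⊓ y) (t ⊓ y) + f (s ⊔ y) (t ⊔ y)) = f y (s ⊔ y) + f s t := by
    rw [← h₁]; abel
  exact (add_left_cancel h).symm

end IsMeasure

/-- `Splitting f s t a b` says that there is a finite chain from `s` to `t` whose steps are coloured
with two colours in such a way that the steps of the first colour have total measure `a` and those
of the second colour have total measure `b`. -/
inductive Splitting (f : L → L → A) : L → L → A → A → Prop
  | refl (x : L) : Splitting f x x 0 0
  | left {s r t : L} {a b : A} : s ≤ r → Splitting f r t a b → Splitting f s t (f s r + a) b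
  | right {s r t : L} {a b : A} : s ≤ r → Splitting f r t a b → Splitting f s t a (f s r + b)

namespace Splitting

variable {f : L → L → A} {s r t : L} {a b a' b' : A}

theorem le (h : Splitting f s t a b) : s ≤ t := by
  induction h with
  | refl => exact le_rfl
  | left h _ ih => exact h.trans ih
  | right h _ ih => exact h.trans ih

theorem add_eq (hf : IsMeasure f) (h : Splitting f s t a b) : a + b = f s t := by
  induction h with
  | refl x => simp [hf.self]
  | left h h' ih => rw [hf.add h h'.le, ← ih]; abel
  | right h h' ih => rw [hf.add h h'.le, ← ih]; abel

theorem trans (h : Splitting f s r a b) (h' : Splitting f r t a' b') :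
    Splitting f s t (a + a') (b + b') := by
  induction h with
  | refl => simpa using h'
  | left h _ ih => rw [add_assoc]; exact left h (ih h')
  | right h _ ih => rw [add_assoc]; exact right h (ih h')

theorem map {B : Type*} [AddCommGroup B] (φ : A →+ B) (h : Splitting f s t a b) :
    Splitting (fun x y => φ (f x y)) s t (φ a) (φ b) := by
  induction h with
  | refl x => simpa using refl x
  | left h _ ih => rw [map_add]; exact left h ih
  | right h _ ih => rw [map_add]; exact right h ih

theorem nonneg [PartialOrder A] [IsOrderedAddMonoid A] (hf : ∀ {x y}, x ≤ y → 0 ≤ f x y)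
    (h : Splitting f s t a b) : 0 ≤ a ∧ 0 ≤ b := by
  induction h with
  | refl => exact ⟨le_rfl, le_rfl⟩
  | left h _ ih => exact ⟨add_nonneg (hf h) ih.1, ih.2⟩
  | right h _ ih => exact ⟨ih.1, add_nonneg (hf h) ih.2⟩

theorem eq_zero (hf : IsMeasure f) (h : Splitting f s t a b) (hst : s = t) : a = 0 ∧ b = 0 := by
  have key : ∀ {r}, s ≤ r → r ≤ t → f s r = 0 := fun h₁ h₂ => by
    rw [le_antisymm (h₂.trans_eq hst.symm) h₁, hf.self]
  induction h with
  | refl => exact ⟨rfl, rfl⟩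
  | @left s r t a b h h' ih =>
    obtain rfl : s = r := le_antisymm h (h'.le.trans_eq hst.symm)
    simpa [hf.self] using ih hst key
  | @right s r t a b h h' ih =>
    obtain rfl : s = r := le_antisymm h (h'.le.trans_eq hst.symm)
    simpa [hf.self] using ih hst key

/-- A coloured chain can be projected below and above any element `y`. -/
theorem inf_sup (hf : IsMeasure f) (h : Splitting f s t a b) (y : L) :
    ∃ a₁ b₁ a₂ b₂, Splitting f (s ⊓ y) (t ⊓ y) a₁ b₁ ∧ Splitting f (s ⊔ y) (t ⊔ y) a₂ b₂ ∧
      a₁ + a₂ = a ∧ b₁ + b₂ = b := by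
  induction h with
  | refl x => exact ⟨0, 0, 0, 0, refl _, refl _, by simp, by simp⟩
  | left h _ ih =>
    obtain ⟨a₁, b₁, a₂, b₂, h₁, h₂, rfl, rfl⟩ := ih
    refine ⟨_, _, _, _, left (inf_le_inf_right y h) h₁, left (sup_le_sup_right h y) h₂, ?_, rfl⟩
    rw [hf.inf_add_sup h y]; abel
  | right h _ ih =>
    obtain ⟨a₁, b₁, a₂, b₂, h₁, h₂, rfl, rfl⟩ := ih
    refine ⟨_, _, _, _, right (inf_le_inf_right y h) h₁, right (sup_le_sup_right h y) h₂, rfl, ?_⟩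
    rw [hf.inf_add_sup h y]; abel

theorem iff_exists_add (hf : IsMeasure f) (hsr : s ≤ r) (hrt : r ≤ t) :
    Splitting f s t a b ↔ ∃ a₁ b₁ a₂ b₂, Splitting f s r a₁ b₁ ∧ Splitting f r t a₂ b₂ ∧
      a₁ + a₂ = a ∧ b₁ + b₂ = b := by
  constructor
  · intro h
    simpa [hsr, hrt] using h.inf_sup hf r
  · rintro ⟨a₁, b₁, a₂, b₂, h₁, h₂, rfl, rfl⟩
    exact h₁.trans h₂

theorem perspective_iff (hf : IsMeasure f) (x y : L) :
    Splitting f (x ⊓ y) x a b ↔ Splitting f y (x ⊔ y) a b := by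
  constructor <;> intro h
  · obtain ⟨a₁, b₁, a₂, b₂, h₁, h₂, rfl, rfl⟩ := h.inf_sup hf y
    obtain ⟨rfl, rfl⟩ := h₁.eq_zero hf (by simp)
    simpa using h₂
  · obtain ⟨a₁, b₁, a₂, b₂, h₁, h₂, rfl, rfl⟩ := h.inf_sup hf x
    obtain ⟨rfl, rfl⟩ := h₂.eq_zero hf (by simp [sup_comm])
    simpa [inf_comm] using h₁

end Splitting

open scoped Pointwise

/-- The set of values of the two colours over all coloured subdivisions of the intervals in a
multiset, as an additive map to sets of pairs under pointwise addition. -/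
def splittings (f : L → L → A) : Multiset (LePair L) →+ Set (A × A) :=
  Multiset.sumAddMonoidHom.comp
    (Multiset.mapAddMonoidHom fun p => {q : A × A | Splitting f p.1.1 p.1.2 q.1 q.2})

@[simp] theorem splittings_singleton (f : L → L → A) (p : LePair L) :
    splittings f {p} = {q : A × A | Splitting f p.1.1 p.1.2 q.1 q.2} := by
  simp [splittings]

theorem splittings_eq_of_dimRel {f : L → L → A} (hf : IsMeasure f) {M N : Multiset (LePair L)}
    (h : DimRel L M N) : splittings f M = splittings f N := by
  cases h with
  | refl x =>
    ext ⟨a, b⟩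
    simp only [gen, splittings_singleton, Set.mem_ofPred_eq, map_zero, Set.mem_zero, Prod.mk_eq_zero]
    exact ⟨fun h => h.eq_zero hf rfl, by rintro ⟨rfl, rfl⟩; exact .refl x⟩
  | add x y z hxy hyz =>
    ext ⟨a, b⟩
    simp only [gen, splittings_singleton, Set.mem_ofPred_eq, map_add, Set.mem_add, Prod.exists,
      Prod.mk_add_mk, Prod.mk.injEq, Splitting.iff_exists_add hf hxy hyz]
    constructor
    · rintro ⟨a₁, b₁, a₂, b₂, h₁, h₂, h⟩
      exact ⟨a₁, b₁, h₁, a₂, b₂, h₂, h⟩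
    · rintro ⟨a₁, b₁, h₁, a₂, b₂, h₂, h⟩
      exact ⟨a₁, b₁, a₂, b₂, h₁, h₂, h⟩
  | perspective x y =>
    ext ⟨a, b⟩
    simp only [gen, splittings_singleton, Set.mem_ofPred_eq, Splitting.perspective_iff hf]

/-- The class in `Dim L` of a formal sum of intervals. -/
def Dim.mk (L : Type*) [Lattice L] : Multiset (LePair L) →+ Dim L :=
  (addConGen (DimRel L)).mk'

theorem Dim.mk_surjective : Function.Surjective (Dim.mk L) :=
  AddCon.mk'_surjective

theorem Dim.mk_eq_of_dimRel {M N : Multiset (LePair L)} (h : DimRel L M N) :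
    Dim.mk L M = Dim.mk L N :=
  (AddCon.eq _).2 (AddConGen.Rel.of _ _ h)

/-- The possible coloured subdivisions of a formal sum depend only on its class in `Dim L`. -/
theorem splittings_eq_of_mk_eq {f : L → L → A} (hf : IsMeasure f) {M N : Multiset (LePair L)}
    (h : Dim.mk L M = Dim.mk L N) : splittings f M = splittings f N := by
  have hle : addConGen (DimRel L) ≤ AddCon.ker (splittings f) :=
    AddCon.addConGen_le.2 fun _ _ h => splittings_eq_of_dimRel hf h
  exact hle ((AddCon.eq _).1 h)

open Classical in
/-- The measure on `L` induced by a homomorphism from `Dim L` to a group; it takes the value `0`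
at pairs that are not in increasing order. -/
noncomputable def dimMeasure (φ : Dim L →+ A) (x y : L) : A :=
  if h : x ≤ y then φ (Dim.mk L (gen x y h)) else 0

theorem dimMeasure_of_le (φ : Dim L →+ A) {x y : L} (h : x ≤ y) :
    dimMeasure φ x y = φ (Dim.mk L (gen x y h)) :=
  dif_pos h

theorem isMeasure_dimMeasure (φ : Dim L →+ A) : IsMeasure (dimMeasure φ) where
  self x := by
    rw [dimMeasure_of_le φ le_rfl, Dim.mk_eq_of_dimRel (.refl x), map_zero, map_zero]
  add {x y z} h h' := by
    rw [dimMeasure_of_le φ h, dimMeasure_of_le φ h', dimMeasure_of_le φ (h.trans h'),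
      Dim.mk_eq_of_dimRel (.add x y z h h'), map_add, map_add]
  perspective x y := by
    rw [dimMeasure_of_le φ inf_le_left, dimMeasure_of_le φ le_sup_right,
      Dim.mk_eq_of_dimRel (.perspective x y)]

theorem map_mk_eq_sum (φ : Dim L →+ A) (M : Multiset (LePair L)) :
    φ (Dim.mk L M) = (M.map fun p => dimMeasure φ p.1.1 p.1.2).sum := by
  induction M using Multiset.induction with
  | empty => simp
  | cons p M ih =>
    rw [← Multiset.singleton_add, map_add, map_add, ih, Multiset.map_add, Multiset.sum_add,
      Multiset.map_singleton, Multiset.sum_singleton, dimMeasure_of_le φ p.2]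
    rfl

theorem mem_splittings_left (φ : Dim L →+ A) (M : Multiset (LePair L)) :
    (φ (Dim.mk L M), 0) ∈ splittings (dimMeasure φ) M := by
  rw [map_mk_eq_sum]
  induction M using Multiset.induction with
  | empty => simp
  | cons p M ih =>
    rw [← Multiset.singleton_add, map_add, Multiset.map_add, Multiset.sum_add]
    refine ⟨(dimMeasure φ p.1.1 p.1.2, 0), ?_, _, ih, by simp⟩
    simpa using Splitting.left (f := dimMeasure φ) p.2 (.refl p.1.2)

theorem mem_splittings_right (φ : Dim L →+ A) (M : Multiset (LePair L)) :
    (0, φ (Dim.mk L M)) ∈ splittings (dimMeasure φ) M := by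
  rw [map_mk_eq_sum]
  induction M using Multiset.induction with
  | empty => simp
  | cons p M ih =>
    rw [← Multiset.singleton_add, map_add, Multiset.map_add, Multiset.sum_add]
    refine ⟨(0, dimMeasure φ p.1.1 p.1.2), ?_, _, ih, by simp⟩
    simpa using Splitting.right (f := dimMeasure φ) p.2 (.refl p.1.2)

/-- Decompositions in `Dim L` are visible in the lattice: if a formal sum of intervals is `α + β` in
`Dim L`, then its intervals have coloured subdivisions with total values `φ α` and `φ β`. -/
theorem mem_splittings_of_mk_eq_add (φ : Dim L →+ A) {M : Multiset (LePair L)} {α β : Dim L}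
    (h : Dim.mk L M = α + β) : (φ α, φ β) ∈ splittings (dimMeasure φ) M := by
  obtain ⟨M₁, rfl⟩ := Dim.mk_surjective α
  obtain ⟨M₂, rfl⟩ := Dim.mk_surjective β
  rw [← map_add] at h
  rw [splittings_eq_of_mk_eq (isMeasure_dimMeasure φ) h, map_add]
  exact ⟨_, mem_splittings_left φ M₁, _, mem_splittings_right φ M₂, by simp⟩

theorem splittings_nonneg_add_eq {f : L → L → A} [PartialOrder A] [IsOrderedAddMonoid A]
    (hf : IsMeasure f) (hf₀ : ∀ {x y}, x ≤ y → 0 ≤ f x y) (M : Multiset (LePair L)) :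
    ∀ q ∈ splittings f M, 0 ≤ q.1 ∧ 0 ≤ q.2 ∧ q.1 + q.2 = (M.map fun p => f p.1.1 p.1.2).sum := by
  induction M using Multiset.induction with
  | empty => simp +contextual
  | cons p M ih =>
    rw [← Multiset.singleton_add, map_add, Multiset.map_add, Multiset.sum_add]
    rintro _ ⟨q, hq, q', hq', rfl⟩
    rw [splittings_singleton] at hq
    obtain ⟨h₁, h₂, h₃⟩ := ih q' hq'
    have h₄ := Splitting.nonneg hf₀ hq
    refine ⟨add_nonneg h₄.1 h₁, add_nonneg h₄.2 h₂, ?_⟩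
    rw [← h₃, Multiset.map_singleton, Multiset.sum_singleton, ← Splitting.add_eq hf hq]
    simp only [Prod.fst_add, Prod.snd_add]
    abel

end Measures

/-! ### Integer-valued measures -/

section
variable {L : Type*} [Lattice L]

namespace IsMeasure

variable {m : L → L → ℤ} {x y z s t : L}

theorem dist_triangle (hm : IsMeasure m) (h₀ : ∀ {x y}, x ≤ y → 0 ≤ m x y) (x y z : L) :
    m (x ⊓ z) (x ⊔ z) ≤ m (x ⊓ y) (x ⊔ y) + m (y ⊓ z) (y ⊔ z) := by
  have mono : ∀ {a b c d : L}, a ≤ b → b ≤ c → c ≤ d → m b c ≤ m a d := fun h₁ h₂ h₃ => by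
    linarith [hm.add h₁ (h₂.trans h₃), hm.add h₂ h₃, h₀ h₁, h₀ h₃]
  -- Both ends go through `y`: the part above `y` and the part below `y` are each subadditive.
  have hup : m y (x ⊔ y ⊔ z) ≤ m y (x ⊔ y) + m y (y ⊔ z) := by
    have h₁ := hm.add (le_sup_right : y ≤ x ⊔ y) (le_sup_left : x ⊔ y ≤ x ⊔ y ⊔ z)
    have h₂ := hm.perspective z (x ⊔ y)
    have h₃ := hm.perspective z y
    have h₄ : m (z ⊓ (x ⊔ y)) z ≤ m (z ⊓ y) z :=
      mono (inf_le_inf_left z le_sup_right) inf_le_left le_rfl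
    rw [sup_comm z] at h₂ h₃
    linarith
  have hdown : m (x ⊓ y ⊓ z) y ≤ m (x ⊓ y) y + m (y ⊓ z) y := by
    have h₁ := hm.add (inf_le_left : x ⊓ y ⊓ z ≤ x ⊓ y) (inf_le_right : x ⊓ y ≤ y)
    have h₂ := hm.perspective (x ⊓ y) z
    have h₃ := hm.perspective y z
    have h₄ : m z (x ⊓ y ⊔ z) ≤ m z (y ⊔ z) :=
      mono le_rfl le_sup_right (sup_le_sup_right inf_le_right z)
    linarith
  have h₁ := hm.add (inf_le_right : x ⊓ y ≤ y) (le_sup_right : y ≤ x ⊔ y)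
  have h₂ := hm.add (inf_le_left : y ⊓ z ≤ y) (le_sup_left : y ≤ y ⊔ z)
  have h₃ := hm.add (inf_le_left.trans inf_le_right : x ⊓ y ⊓ z ≤ y)
    (le_sup_right.trans le_sup_left : y ≤ x ⊔ y ⊔ z)
  have h₄ : m (x ⊓ z) (x ⊔ z) ≤ m (x ⊓ y ⊓ z) (x ⊔ y ⊔ z) :=
    mono (le_inf (inf_le_left.trans inf_le_left) inf_le_right) (inf_le_left.trans le_sup_left)
      (sup_le (le_sup_left.trans le_sup_left) le_sup_right)
  linarith

/-- On an interval of measure one, elements are separated by an integer-valued measure exactly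
according to their measure above the bottom of the interval. -/
theorem dist_of_eq_one (hm : IsMeasure m) (h₀ : ∀ {x y}, x ≤ y → 0 ≤ m x y)
    (hsx : s ≤ x) (hxt : x ≤ t) (hsy : s ≤ y) (hyt : y ≤ t) (hst : m s t = 1) :
    (m s x = m s y → m (x ⊓ y) (x ⊔ y) = 0) ∧ (m s x ≠ m s y → 0 < m (x ⊓ y) (x ⊔ y)) := by
  have h₁ := hm.add (le_inf hsx hsy) (inf_le_left : x ⊓ y ≤ x)
  have h₂ := hm.add (le_inf hsx hsy) (inf_le_right : x ⊓ y ≤ y)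
  have h₃ := hm.add (inf_le_left : x ⊓ y ≤ x) (le_sup_left : x ≤ x ⊔ y)
  have h₄ := hm.perspective y x
  rw [inf_comm, sup_comm] at h₄
  have h₅ := hm.add (hsx.trans (le_sup_left : x ≤ x ⊔ y)) (sup_le hxt hyt)
  have h₆ := hm.add hsx (le_sup_left : x ≤ x ⊔ y)
  have p₁ := h₀ (le_inf hsx hsy)
  have p₂ := h₀ (inf_le_left : x ⊓ y ≤ x)
  have p₃ := h₀ (inf_le_right : x ⊓ y ≤ y)
  have p₄ := h₀ (sup_le hxt hyt)
  constructor <;> intro h <;> omega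

end IsMeasure

/-- In a coloured chain on which `φ` sees one unit, of the second colour, and `ψ` sees one unit, of
the first colour, the two units lie on different steps, so some element of the chain
lies between them. Which unit comes first cannot be prescribed. -/
theorem Splitting.exists_separating {A : Type*} [AddCommGroup A] {f : L → L → A}
    (hf : IsMeasure f) {φ ψ : A →+ ℤ}
    (hφ : ∀ {x y}, x ≤ y → 0 ≤ φ (f x y)) (hψ : ∀ {x y}, x ≤ y → 0 ≤ ψ (f x y))
    {s t : L} {a b : A} (h : Splitting f s t a b)
    (ha : φ a = 0) (ha' : ψ a = 1) (hb : φ b = 1) (hb' : ψ b = 0) :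
    ∃ w, s ≤ w ∧ w ≤ t ∧ ((φ (f s w) = 0 ∧ ψ (f s w) = 1) ∨ (φ (f s w) = 1 ∧ ψ (f s w) = 0)) := by
  have hφ' : ∀ {s t a b}, Splitting f s t a b → 0 ≤ φ a ∧ 0 ≤ φ b := fun h => (h.map φ).nonneg hφ
  have hψ' : ∀ {s t a b}, Splitting f s t a b → 0 ≤ ψ a ∧ 0 ≤ ψ b := fun h => (h.map ψ).nonneg hψ
  induction h with
  | refl => simp at ha'
  | @left s r t a b h h' ih =>
    have h₁ := hφ h
    have h₂ := hψ h
    have h₃ := hφ' h'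
    have h₄ := hψ' h'
    rw [map_add] at ha ha'
    by_cases hr : ψ (f s r) = 1
    · exact ⟨r, h, h'.le, .inl ⟨by omega, hr⟩⟩
    · obtain ⟨w, hw, hw', hw''⟩ := ih (by omega) (by omega) hb hb'
      refine ⟨w, h.trans hw, hw', ?_⟩
      rw [hf.add h hw, map_add, map_add]
      omega
  | @right s r t a b h h' ih =>
    have h₁ := hφ h
    have h₂ := hψ h
    have h₃ := hφ' h'
    have h₄ := hψ' h'
    rw [map_add] at hb hb'
    by_cases hr : φ (f s r) = 1
    · exact ⟨r, h, h'.le, .inr ⟨hr, by omega⟩⟩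
    · obtain ⟨w, hw, hw', hw''⟩ := ih ha ha' (by omega) (by omega)
      refine ⟨w, h.trans hw, hw', ?_⟩
      rw [hf.add h hw, map_add, map_add]
      omega
end

/-! ### Free triples -/

section FreeTriples
open Cardinal

theorem exists_notMem_of_mk_lt {α : Type u} {X Y : Set α} (h : #Y < #X) : ∃ x ∈ X, x ∉ Y := by
  by_contra! h'
  exact absurd (mk_le_mk_of_subset h') (not_le.2 h)

/-- Kuratowski's free set theorem for pairs: on a set of cardinality at least `ℵ₂`, a map sending
pairs to finite sets admits a triple each member of which avoids the value at the other two. -/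
theorem exists_free_triple {α : Type u} {X : Set α} (hX : aleph 2 ≤ #X) (F : α → α → Finset α) :
    ∃ x ∈ X, ∃ y ∈ X, ∃ z ∈ X, x ∉ F y z ∧ y ∉ F x z ∧ z ∉ F x y := by
  have h01 : ℵ₀ < aleph 1 := aleph_zero ▸ aleph_lt_aleph.2 zero_lt_one
  have h12 : aleph 1 < aleph 2 := aleph_lt_aleph.2 one_lt_two
  obtain ⟨A, hAX, hA⟩ := le_mk_iff_exists_subset.1 (h12.le.trans hX)
  obtain ⟨B, hBA, hB⟩ := le_mk_iff_exists_subset.1 (h01.le.trans_eq hA.symm)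
  obtain ⟨z, hz, hz'⟩ : ∃ z ∈ X, z ∉ ⋃ p : A × A, (F p.1 p.2 : Set α) := by
    refine exists_notMem_of_mk_lt (lt_of_le_of_lt ?_ (h12.trans_le hX))
    refine (mk_iUnion_le _).trans (mul_le_of_le h01.le ?_ ?_)
    · rw [mk_prod, lift_id, hA, mul_eq_self h01.le]
    · exact ciSup_le' fun p => (lt_aleph0_of_finite _).le.trans h01.le
  obtain ⟨y, hy, hy'⟩ : ∃ y ∈ A, y ∉ ⋃ x : B, (F x z : Set α) := by
    refine exists_notMem_of_mk_lt (lt_of_le_of_lt ?_ (h01.trans_eq hA.symm))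
    refine (mk_iUnion_le _).trans (mul_le_of_le le_rfl hB.le ?_)
    exact ciSup_le' fun p => (lt_aleph0_of_finite _).le
  obtain ⟨x, hx, hx'⟩ : ∃ x ∈ B, x ∉ (F y z : Set α) :=
    exists_notMem_of_mk_lt (hB ▸ lt_aleph0_of_finite _)
  simp only [Set.mem_iUnion, not_exists] at hz' hy'
  exact ⟨x, hAX (hBA hx), y, hAX hy, z, hz, hx', hy' ⟨x, hx⟩, hz' (⟨x, hBA hx⟩, ⟨y, hy⟩)⟩

end FreeTriples

/-! ### The dimension group -/

section CubeGroup
variable {Ω : Type u} [DecidableEq Ω]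

/-- The pair `g = (u, v)` is determined by its values inside `F`: `u` depends only on `A ∩ F`, and
at each triple that is not contained in `F` the value of `v` is computed from `u`. -/
def SupportedOn (F : Finset Ω) (g : (Finset Ω → ℤ) × (Ω × Ω × Ω → ℤ)) : Prop :=
  (∀ A, g.1 A = g.1 (A ∩ F)) ∧ ∀ x y z, ¬ (x ∈ F ∧ y ∈ F ∧ z ∈ F) →
    g.2 (x, y, z) = g.1 {x, y} + g.1 {y, z} + g.1 ∅ - g.1 {y}

theorem SupportedOn.mono {F F' : Finset Ω} {g : (Finset Ω → ℤ) × (Ω × Ω × Ω → ℤ)}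
    (h : SupportedOn F g) (hF : F ⊆ F') : SupportedOn F' g := by
  refine ⟨fun A => ?_, fun x y z hn => h.2 x y z fun hh => hn ⟨hF hh.1, hF hh.2.1, hF hh.2.2⟩⟩
  rw [h.1 A, h.1 (A ∩ F'), Finset.inter_assoc, Finset.inter_eq_right.2 hF]

theorem SupportedOn.apply_eq {F : Finset Ω} {g : (Finset Ω → ℤ) × (Ω × Ω × Ω → ℤ)}
    (h : SupportedOn F g) {A B : Finset Ω} (hAB : ∀ x ∈ F, x ∈ A ↔ x ∈ B) : g.1 A = g.1 B := by
  have : A ∩ F = B ∩ F := by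
    ext x
    simp only [Finset.mem_inter]
    exact and_congr_left (hAB x)
  rw [h.1 A, h.1 B, this]

/-- Outside `F` the formula for the value at a triple is a sum of two values at finite sets. The
two sets depend on which entry of the triple is missing from `F`: with `x, y` in `F` they are
`{x, y}` and `∅`, with `y, z` in `F` they are `{y, z}` and `∅`, and with `x, z` in `F` they are
`{x}` and `{z}`. -/
theorem SupportedOn.exists_two {F : Finset Ω} {x y z : Ω} (hn : ¬ (x ∈ F ∧ y ∈ F ∧ z ∈ F)) :
    ∃ A B : Finset Ω, ∀ u : Finset Ω → ℤ, (∀ A, u A = u (A ∩ F)) →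
      u {x, y} + u {y, z} + u ∅ - u {y} = u A + u B := by
  by_cases hx : x ∈ F
  · by_cases hy : y ∈ F
    · have hz : z ∉ F := fun hz => hn ⟨hx, hy, hz⟩
      refine ⟨{x, y}, ∅, fun u hu => ?_⟩
      have : u {y, z} = u {y} := by rw [hu, hu {y}, Finset.insert_inter_of_mem hy]; simp [hy, hz]
      linarith
    · refine ⟨{x}, {z}, fun u hu => ?_⟩
      have h₁ : u {x, y} = u {x} := by rw [hu, hu {x}, Finset.insert_inter_of_mem hx]; simp [hx, hy]
      have h₂ : u {y, z} = u {z} := by rw [hu, hu {z}, Finset.insert_inter_of_notMem hy]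
      have h₃ : u {y} = u ∅ := by rw [hu, hu ∅]; simp [hy]
      linarith
  · refine ⟨{y, z}, ∅, fun u hu => ?_⟩
    have h₁ : u {x, y} = u {y} := by rw [hu, hu {y}, Finset.insert_inter_of_notMem hx]
    linarith

variable (Ω) in
/-- The group of the finitely supported pairs of integer functions, on the finite subsets of `Ω`
and on the triples of elements of `Ω`, ordered pointwise. -/
def cubeGroup : AddSubgroup ((Finset Ω → ℤ) × (Ω × Ω × Ω → ℤ)) where
  carrier := {g | ∃ F, SupportedOn F g}
  zero_mem' := ⟨∅, by simp [SupportedOn]⟩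
  add_mem' := by
    rintro g g' ⟨F, h⟩ ⟨F', h'⟩
    have h₁ := h.mono (Finset.subset_union_left (s₂ := F'))
    have h₂ := h'.mono (Finset.subset_union_right (s₁ := F))
    refine ⟨F ∪ F', fun A => ?_, fun x y z hn => ?_⟩
    · simp only [Prod.fst_add, Pi.add_apply]
      rw [h₁.1, h₂.1]
    · simp only [Prod.fst_add, Prod.snd_add, Pi.add_apply, h₁.2 x y z hn, h₂.2 x y z hn]
      ring
  neg_mem' := by
    rintro g ⟨F, h⟩
    refine ⟨F, fun A => ?_, fun x y z hn => ?_⟩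
    · simp only [Prod.fst_neg, Pi.neg_apply]
      rw [h.1]
    · simp only [Prod.fst_neg, Prod.snd_neg, Pi.neg_apply, h.2 x y z hn]
      ring

namespace cubeGroup

/-- Evaluation at a finite set. -/
def evalFinset (A : Finset Ω) : cubeGroup Ω →+ ℤ :=
  ((Pi.evalAddMonoidHom _ A).comp (AddMonoidHom.fst _ _)).comp (cubeGroup Ω).subtype

/-- Evaluation at a triple. -/
def evalTriple (p : Ω × Ω × Ω) : cubeGroup Ω →+ ℤ :=
  ((Pi.evalAddMonoidHom _ p).comp (AddMonoidHom.snd _ _)).comp (cubeGroup Ω).subtype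

theorem le_iff {g g' : cubeGroup Ω} :
    g ≤ g' ↔ (∀ A, evalFinset A g ≤ evalFinset A g') ∧ ∀ p, evalTriple p g ≤ evalTriple p g' :=
  Iff.rfl

theorem ext {g g' : cubeGroup Ω} (h : ∀ A, evalFinset A g = evalFinset A g')
    (h' : ∀ p, evalTriple p g = evalTriple p g') : g = g' :=
  le_antisymm (le_iff.2 ⟨fun A => (h A).le, fun p => (h' p).le⟩)
    (le_iff.2 ⟨fun A => (h A).ge, fun p => (h' p).ge⟩)

theorem nonneg_iff {g : cubeGroup Ω} :
    0 ≤ g ↔ (∀ A, 0 ≤ evalFinset A g) ∧ ∀ p, 0 ≤ evalTriple p g :=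
  Iff.rfl

/-- A chosen finite set on which `g` is supported; it need not be the least one. -/
noncomputable def supp (g : cubeGroup Ω) : Finset Ω := g.2.choose

theorem supp_spec (g : cubeGroup Ω) : SupportedOn (supp g) g.1 := g.2.choose_spec

/-- The order-unit, with value `1` at the finite sets and `2` at the triples. -/
def unit : cubeGroup Ω := ⟨(fun _ => 1, fun _ => 2), ∅, by simp [SupportedOn]⟩

/-- The element with value `1` at the finite sets containing `x` and `0` at the others; its values
at triples are the ones computed from these. -/
def indicator (x : Ω) : cubeGroup Ω :=
  ⟨(fun A => if x ∈ A then 1 else 0, fun p => (if x ∈ ({p.1, p.2.1} : Finset Ω) then 1 else 0) +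
    (if x ∈ ({p.2.1, p.2.2} : Finset Ω) then 1 else 0) - if x ∈ ({p.2.1} : Finset Ω) then 1 else 0),
    {x}, by simp [SupportedOn]⟩

/-- The element whose only nonzero value is `1`, at the triple `(x, x, x)`. -/
def tripleAtom (x : Ω) : cubeGroup Ω :=
  ⟨(0, Pi.single (x, x, x) 1), {x}, by simp, fun a b c h => by
    have : (a, b, c) ≠ (x, x, x) := fun h' => h (by simp_all)
    simp [this]⟩

@[simp] theorem evalFinset_unit (A : Finset Ω) : evalFinset A unit = 1 := rfl
@[simp] theorem evalTriple_unit (p : Ω × Ω × Ω) : evalTriple p unit = 2 := rfl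
@[simp] theorem evalFinset_indicator (A : Finset Ω) (x : Ω) :
    evalFinset A (indicator x) = if x ∈ A then 1 else 0 := rfl
theorem evalTriple_indicator (p : Ω × Ω × Ω) (x : Ω) : evalTriple p (indicator x) =
    (if x ∈ ({p.1, p.2.1} : Finset Ω) then 1 else 0) +
      (if x ∈ ({p.2.1, p.2.2} : Finset Ω) then 1 else 0) -
      if x ∈ ({p.2.1} : Finset Ω) then 1 else 0 := rfl
@[simp] theorem evalFinset_tripleAtom (A : Finset Ω) (x : Ω) :
    evalFinset A (tripleAtom x) = 0 := rfl
theorem evalTriple_tripleAtom (p : Ω × Ω × Ω) (x : Ω) :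
    evalTriple p (tripleAtom x) = Pi.single (M := fun _ => ℤ) (x, x, x) 1 p := rfl

theorem indicator_nonneg (x : Ω) : 0 ≤ indicator x := by
  refine nonneg_iff.2 ⟨fun A => ?_, fun p => ?_⟩
  · rw [evalFinset_indicator]; split_ifs <;> simp
  · rw [evalTriple_indicator]
    simp only [Finset.mem_insert, Finset.mem_singleton]
    split_ifs <;> simp_all

theorem indicator_le_unit (x : Ω) : indicator x ≤ unit := by
  refine le_iff.2 ⟨fun A => ?_, fun p => ?_⟩
  · rw [evalFinset_indicator, evalFinset_unit]; split_ifs <;> simp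
  · rw [evalTriple_unit, evalTriple_indicator]
    simp only [Finset.mem_insert, Finset.mem_singleton]
    split_ifs <;> simp_all

theorem unit_nonneg : 0 ≤ (unit : cubeGroup Ω) :=
  nonneg_iff.2 ⟨by simp, by simp⟩

theorem exists_le_nsmul_unit (g : cubeGroup Ω) : ∃ n : ℕ, g ≤ n • unit := by
  obtain ⟨F, hF⟩ := g.2
  obtain ⟨n, hn⟩ : ∃ n : ℕ, (∀ A ∈ F.powerset, evalFinset A g ≤ n) ∧
      ∀ p ∈ F ×ˢ F ×ˢ F, evalTriple p g ≤ n := by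
    refine ⟨∑ A ∈ F.powerset, (evalFinset A g).natAbs +
      ∑ p ∈ F ×ˢ F ×ˢ F, (evalTriple p g).natAbs, fun A hA => ?_, fun p hp => ?_⟩
    · have := Finset.single_le_sum (f := fun A => (evalFinset A g).natAbs)
        (fun _ _ => Nat.zero_le _) hA
      omega
    · have := Finset.single_le_sum (f := fun p => (evalTriple p g).natAbs)
        (fun _ _ => Nat.zero_le _) hp
      omega
  have h₁ : ∀ A, evalFinset A g ≤ n := fun A => by
    have := hn.1 (A ∩ F) (Finset.mem_powerset.2 Finset.inter_subset_right)
    exact (hF.1 A).trans_le this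
  refine ⟨n, le_iff.2 ⟨fun A => by simpa using h₁ A, fun ⟨x, y, z⟩ => ?_⟩⟩
  rw [map_nsmul, evalTriple_unit, nsmul_eq_mul]
  by_cases h : x ∈ F ∧ y ∈ F ∧ z ∈ F
  · have := hn.2 (x, y, z) (by simpa using h)
    linarith [Int.natCast_nonneg n]
  · obtain ⟨A, B, hAB⟩ := SupportedOn.exists_two h
    have : evalTriple (x, y, z) g = evalFinset A g + evalFinset B g :=
      (hF.2 x y z h).trans (hAB _ hF.1)
    linarith [h₁ A, h₁ B]

theorem isOrderUnit_unit : IsOrderUnit (unit : cubeGroup Ω) :=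
  ⟨unit_nonneg, exists_le_nsmul_unit⟩

theorem hasIndex_unit [Nonempty Ω] : HasIndex (unit : cubeGroup Ω) 2 := by
  refine ⟨⟨two_pos, fun g hg h => ?_⟩, fun n ⟨hn, h⟩ => ?_⟩
  · rw [nonneg_iff] at hg
    rw [le_iff] at h
    simp only [map_nsmul, evalFinset_unit, evalTriple_unit, nsmul_eq_mul] at h
    push_cast at h
    refine ext (fun A => ?_) fun p => ?_
    · have h₁ := hg.1 A
      have h₂ := h.1 A
      rw [map_zero]; omega
    · have h₁ := hg.2 p
      have h₂ := h.2 p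
      rw [map_zero]; omega
  · by_contra hn'
    obtain rfl : n = 1 := by omega
    obtain ⟨x⟩ := ‹Nonempty Ω›
    have h₀ : tripleAtom x = 0 := by
      refine h _ (nonneg_iff.2 ⟨by simp, fun p => ?_⟩) (le_iff.2 ⟨fun A => ?_, fun p => ?_⟩)
      · rw [evalTriple_tripleAtom]
        exact (Pi.single_nonneg (α := fun _ => ℤ)).2 zero_le_one p
      · simp
      · rw [map_nsmul, evalTriple_tripleAtom, evalTriple_unit, Pi.single_apply]
        split_ifs <;> simp
    have := congrArg (evalTriple (x, x, x)) h₀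
    simp [evalTriple_tripleAtom] at this

/-- Interpolation: maxima are taken at the finite sets and at the triples inside a common support,
and the other triples are sums of two values at finite sets. -/
theorem exists_between (a a' b b' : cubeGroup Ω) (h₁ : a ≤ b) (h₂ : a ≤ b') (h₃ : a' ≤ b)
    (h₄ : a' ≤ b') : ∃ c, a ≤ c ∧ a' ≤ c ∧ c ≤ b ∧ c ≤ b' := by
  obtain ⟨F, ha, ha', hb, hb'⟩ : ∃ F, SupportedOn F a.1 ∧ SupportedOn F a'.1 ∧
      SupportedOn F b.1 ∧ SupportedOn F b'.1 :=
    ⟨supp a ∪ supp a' ∪ supp b ∪ supp b',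
      (supp_spec a).mono (by intro x; simp +contextual),
      (supp_spec a').mono (by intro x; simp +contextual),
      (supp_spec b).mono (by intro x; simp +contextual),
      (supp_spec b').mono (by intro x; simp +contextual)⟩
  let u : Finset Ω → ℤ := fun A => max (evalFinset A a) (evalFinset A a')
  let v : Ω × Ω × Ω → ℤ := fun p =>
    if p.1 ∈ F ∧ p.2.1 ∈ F ∧ p.2.2 ∈ F then max (evalTriple p a) (evalTriple p a')
    else u {p.1, p.2.1} + u {p.2.1, p.2.2} + u ∅ - u {p.2.1}
  have hu : ∀ A, u A = u (A ∩ F) := fun A => congrArg₂ max (ha.1 A) (ha'.1 A)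
  have hv : ∀ {x y z}, x ∈ F ∧ y ∈ F ∧ z ∈ F →
      v (x, y, z) = max (evalTriple (x, y, z) a) (evalTriple (x, y, z) a') := fun h => if_pos h
  have hv' : ∀ {x y z}, ¬ (x ∈ F ∧ y ∈ F ∧ z ∈ F) →
      v (x, y, z) = u {x, y} + u {y, z} + u ∅ - u {y} := fun h => if_neg h
  let c : cubeGroup Ω := ⟨(u, v), F, hu, fun x y z h => hv' h⟩
  -- A comparison at the finite subsets and at the triples in `F` propagates to all triples.
  have key : ∀ g g' : cubeGroup Ω, SupportedOn F g.1 → SupportedOn F g'.1 →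
      (∀ A, evalFinset A g ≤ evalFinset A g') →
      (∀ x y z, x ∈ F ∧ y ∈ F ∧ z ∈ F → evalTriple (x, y, z) g ≤ evalTriple (x, y, z) g') →
      g ≤ g' := fun g g' hg hg' h h' => by
    refine le_iff.2 ⟨h, fun ⟨x, y, z⟩ => ?_⟩
    by_cases hF : x ∈ F ∧ y ∈ F ∧ z ∈ F
    · exact h' x y z hF
    · obtain ⟨A, B, hAB⟩ := SupportedOn.exists_two hF
      have e : evalTriple (x, y, z) g = evalFinset A g + evalFinset B g :=
        (hg.2 x y z hF).trans (hAB _ hg.1)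
      have e' : evalTriple (x, y, z) g' = evalFinset A g' + evalFinset B g' :=
        (hg'.2 x y z hF).trans (hAB _ hg'.1)
      rw [e, e']
      exact add_le_add (h A) (h B)
  have hc : SupportedOn F c.1 := ⟨hu, fun x y z h => hv' h⟩
  refine ⟨c, key _ _ ha hc (fun A => le_max_left _ _) fun x y z h => ?_,
    key _ _ ha' hc (fun A => le_max_right _ _) fun x y z h => ?_,
    key _ _ hc hb (fun A => max_le (h₁.1 A) (h₃.1 A)) fun x y z h => ?_,
    key _ _ hc hb' (fun A => max_le (h₂.1 A) (h₄.1 A)) fun x y z h => ?_⟩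
  · exact (le_max_left _ _).trans_eq (hv h).symm
  · exact (le_max_right _ _).trans_eq (hv h).symm
  · exact (hv h).trans_le (max_le (h₁.2 _) (h₃.2 _))
  · exact (hv h).trans_le (max_le (h₂.2 _) (h₄.2 _))

theorem isDimensionGroup : IsDimensionGroup (cubeGroup Ω) where
  directed g := by
    obtain ⟨n, hn⟩ := exists_le_nsmul_unit g
    exact ⟨n • unit, n • unit - g, nsmul_nonneg unit_nonneg n, sub_nonneg.2 hn, by abel⟩
  unperforated m g hm h := by
    rw [nonneg_iff] at h ⊢
    simp only [map_nsmul, nsmul_eq_mul] at h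
    have hm' : (0 : ℤ) < m := by exact_mod_cast hm
    exact ⟨fun A => nonneg_of_mul_nonneg_right (h.1 A) hm',
      fun p => nonneg_of_mul_nonneg_right (h.2 p) hm'⟩
  interpolation := exists_between

open Cardinal in
theorem mk_eq [Infinite Ω] : #(cubeGroup Ω) = #Ω := by
  refine le_antisymm ?_ ?_
  -- An element is encoded by a support and its values inside that support.
  · let code : cubeGroup Ω → Finset Ω × (Finset Ω →₀ ℤ) × (Ω × Ω × Ω →₀ ℤ) := fun g =>
      (supp g, Finsupp.onFinset (supp g).powerset
          (fun A => if A ⊆ supp g then evalFinset A g else 0) (by simp +contextual),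
        Finsupp.onFinset (supp g ×ˢ supp g ×ˢ supp g) (fun p =>
          if p.1 ∈ supp g ∧ p.2.1 ∈ supp g ∧ p.2.2 ∈ supp g then evalTriple p g else 0)
          (by simp +contextual))
    have hcode : Function.Injective code := fun g g' h => by
      simp only [code, Prod.mk.injEq] at h
      obtain ⟨hs, h₁, h₂⟩ := h
      have hg := supp_spec g
      have hg' := supp_spec g'
      rw [← hs] at h₁ h₂ hg'
      have e₁ : ∀ A, evalFinset A g = evalFinset A g' := fun A => by
        have := DFunLike.congr_fun h₁ (A ∩ supp g)
        simp only [Finsupp.onFinset_apply, Finset.inter_subset_right, if_true] at this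
        exact (hg.1 A).trans (this.trans (hg'.1 A).symm)
      refine ext e₁ fun ⟨x, y, z⟩ => ?_
      by_cases hF : x ∈ supp g ∧ y ∈ supp g ∧ z ∈ supp g
      · have := DFunLike.congr_fun h₂ (x, y, z)
        simpa only [Finsupp.onFinset_apply, hF, and_self, if_true] using this
      · refine (hg.2 x y z hF).trans (Eq.trans ?_ (hg'.2 x y z hF).symm)
        exact congrArg₂ _ (congrArg₂ _ (congrArg₂ _ (e₁ _) (e₁ _)) (e₁ _)) (e₁ _)
    refine (mk_le_of_injective hcode).trans ?_
    have hΩ : ℵ₀ ≤ #Ω := aleph0_le_mk Ω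
    have h₃ : #(Ω × Ω × Ω) = #Ω := by simp [mul_eq_self hΩ]
    have : Infinite (Ω × Ω × Ω) := inferInstance
    simp [mk_finsupp_lift_of_infinite, hΩ, h₃, mul_eq_self hΩ]
  · refine mk_le_of_injective (f := indicator) fun x y h => ?_
    have := congrArg (evalFinset {x}) h
    by_contra hne
    simp [Ne.symm hne] at this

end cubeGroup
end CubeGroup

/-! ### Lattices do not realize the positive cone -/

namespace cubeGroup
variable {Ω : Type u} [DecidableEq Ω] {L : Type v} [Lattice L]

/-- An interval of measure one on `X` cannot contain elements `w x` that have the values `i` at `∅`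
and `j ≠ i` at `{x}`, for `ℵ₂` many `x`. For a free triple the distances from `w x` to `w y` and
from `w y` to `w z` vanish at `(x, y, z)`, but the distance from `w x` to `w z` does not. -/
theorem false_of_separating {f : L → L → cubeGroup Ω} (hf : IsMeasure f)
    (hf₀ : ∀ {x y}, x ≤ y → 0 ≤ f x y) {s t : L} {X : Set Ω} (hX : Cardinal.aleph 2 ≤ Cardinal.mk X)
    (hst : ∀ A : Finset Ω, ↑A ⊆ X → evalFinset A (f s t) = 1)
    {w : Ω → L} (hsw : ∀ x ∈ X, s ≤ w x) (hwt : ∀ x ∈ X, w x ≤ t)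
    {i j : ℤ} (hij : i ≠ j) (hi : ∀ x ∈ X, evalFinset ∅ (f s (w x)) = i)
    (hj : ∀ x ∈ X, evalFinset {x} (f s (w x)) = j) : False := by
  obtain ⟨x, hx, y, hy, z, hz, hx', hy', hz'⟩ := exists_free_triple hX fun x y =>
    supp (f s (w x)) ∪ supp (f s (w y)) ∪ supp (f (w x ⊓ w y) (w x ⊔ w y))
  simp only [Finset.notMem_union] at hx' hy' hz'
  have hA : ∀ A : Finset Ω, IsMeasure fun a b => evalFinset A (f a b) := fun A => hf.map _
  have hA₀ : ∀ (A : Finset Ω) {a b}, a ≤ b → 0 ≤ evalFinset A (f a b) := fun A _ _ h =>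
    (nonneg_iff.1 (hf₀ h)).1 A
  have dist : ∀ {a b}, a ∈ X → b ∈ X → ∀ A : Finset Ω, ↑A ⊆ X →
      (evalFinset A (f s (w a)) = evalFinset A (f s (w b)) →
        evalFinset A (f (w a ⊓ w b) (w a ⊔ w b)) = 0) ∧
      (evalFinset A (f s (w a)) ≠ evalFinset A (f s (w b)) →
        0 < evalFinset A (f (w a ⊓ w b) (w a ⊔ w b))) := fun ha hb A h =>
    (hA A).dist_of_eq_one (hA₀ A) (hsw _ ha) (hwt _ ha) (hsw _ hb) (hwt _ hb) (hst A h)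
  have val : ∀ {a A}, a ∈ X → a ∈ A → (∀ b ∈ A, b ≠ a → b ∉ supp (f s (w a))) →
      evalFinset A (f s (w a)) = j := fun {a A} ha haA h => by
    refine ((supp_spec (f s (w a))).apply_eq fun b hb => ?_).trans (hj a ha)
    rw [Finset.mem_singleton]
    exact ⟨fun hbA => by_contra fun hne => h b hbA hne hb, fun h => h ▸ haA⟩
  have val' : ∀ {a b}, a ∈ X → b ∉ supp (f s (w a)) →
      evalFinset {b} (f s (w a)) = i := fun {a b} ha hb => by
    refine ((supp_spec (f s (w a))).apply_eq fun c hc => ?_).trans (hi a ha)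
    simp only [Finset.mem_singleton, Finset.notMem_empty, iff_false]
    rintro rfl
    exact hb hc
  -- Two lattice elements with values `(i, j)` at `(∅, {a, b})` have distance zero there.
  have pair : ∀ {a b}, a ∈ X → b ∈ X → a ∉ supp (f s (w b)) → b ∉ supp (f s (w a)) →
      evalFinset ∅ (f (w a ⊓ w b) (w a ⊔ w b)) = 0 ∧
      evalFinset {a, b} (f (w a ⊓ w b) (w a ⊔ w b)) = 0 := fun {a b} ha hb hab hba => by
    refine ⟨(dist ha hb ∅ (by simp)).1 ((hi a ha).trans (hi b hb).symm),
      (dist ha hb {a, b} (by simp [Set.insert_subset_iff, ha, hb])).1 ?_⟩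
    rw [val ha (by simp), val hb (by simp)]
    · intro c hc hcb
      obtain rfl : c = a := by simpa [hcb] using hc
      exact hab
    · intro c hc hca
      obtain rfl : c = b := by simpa [hca] using hc
      exact hba
  have hxy := pair hx hy hx'.1.1 hy'.1.1
  have hyz := pair hy hz hy'.1.2 hz'.1.2
  have hxz := pair hx hz hx'.1.2 hz'.1.1
  have hxz₁ : 0 < evalFinset {x} (f (w x ⊓ w z) (w x ⊔ w z)) := by
    refine (dist hx hz {x} (by simpa using hx)).2 ?_
    rw [hj x hx, val' hz hx'.1.2]
    exact hij.symm
  have hxz₂ : 0 < evalFinset {z} (f (w x ⊓ w z) (w x ⊔ w z)) := by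
    refine (dist hx hz {z} (by simpa using hz)).2 ?_
    rw [hj z hz, val' hx hz'.1.1]
    exact hij
  -- At the triple `(x, y, z)` the two short distances vanish and the long one does not.
  have triple : ∀ g : cubeGroup Ω, ¬ (x ∈ supp g ∧ y ∈ supp g ∧ z ∈ supp g) →
      evalTriple (x, y, z) g = evalFinset {x, y} g + evalFinset {y, z} g + evalFinset ∅ g -
        evalFinset {y} g := fun g h => (supp_spec g).2 x y z h
  have congr : ∀ {g : cubeGroup Ω} {A B : Finset Ω}, (∀ c ∈ supp g, c ∈ A ↔ c ∈ B) →
      evalFinset A g = evalFinset B g := fun {g _ _} h => (supp_spec g).apply_eq h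
  have dxy : evalTriple (x, y, z) (f (w x ⊓ w y) (w x ⊔ w y)) = 0 := by
    rw [triple _ fun h => hz'.2 h.2.2, hxy.1, hxy.2,
      congr (A := {y, z}) (B := {y}) fun c hc => ?_]
    · ring
    · have : c ≠ z := fun h => hz'.2 (h ▸ hc)
      simp [this]
  have dyz : evalTriple (x, y, z) (f (w y ⊓ w z) (w y ⊔ w z)) = 0 := by
    rw [triple _ fun h => hx'.2 h.1, hyz.1, hyz.2,
      congr (A := {x, y}) (B := {y}) fun c hc => ?_]
    · ring
    · have : c ≠ x := fun h => hx'.2 (h ▸ hc)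
      simp [this]
  have dxz : 0 < evalTriple (x, y, z) (f (w x ⊓ w z) (w x ⊔ w z)) := by
    have hc : ∀ {c}, c ∈ supp (f (w x ⊓ w z) (w x ⊔ w z)) → c ≠ y := fun hc h => hy'.2 (h ▸ hc)
    rw [triple _ fun h => hy'.2 h.2.1,
      congr (A := {x, y}) (B := {x}) fun c h => by simp [hc h],
      congr (A := {y, z}) (B := {z}) fun c h => by simp [hc h],
      congr (A := {y}) (B := ∅) fun c h => by simp [hc h]]
    linarith
  have := (hf.map (evalTriple (x, y, z))).dist_triangle
    (fun h => (nonneg_iff.1 (hf₀ h)).2 _) (w x) (w y) (w z)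
  linarith

open scoped Pointwise in
/-- Lifting `unit = indicator x + (unit - indicator x)` to `Dim L`, for every `x`, produces elements
`w x` in one fixed interval with values `(0, 1)` or `(1, 0)` at `(∅, {x})`, and one of the two
patterns occurs for `ℵ₂` many `x`. -/
theorem not_exists_surjective_isVHom (hΩ : Cardinal.aleph 2 ≤ Cardinal.mk Ω) :
    ¬ ∃ μ : Dim L →+ AddSubmonoid.nonneg (cubeGroup Ω), IsVHom μ ∧ Function.Surjective μ := by
  rintro ⟨μ, hμ, hsurj⟩
  let φ : Dim L →+ cubeGroup Ω := (AddSubmonoid.nonneg (cubeGroup Ω)).subtype.comp μ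
  have hf := isMeasure_dimMeasure φ
  have hf₀ : ∀ {x y}, x ≤ y → 0 ≤ dimMeasure φ x y := fun h => by
    rw [dimMeasure_of_le φ h]; exact (μ _).2
  obtain ⟨c, hc⟩ := hsurj ⟨unit, unit_nonneg⟩
  obtain ⟨M, rfl⟩ := Dim.mk_surjective c
  have hM : φ (Dim.mk L M) = unit := congrArg Subtype.val hc
  have hsum := map_mk_eq_sum φ M
  -- One of the intervals presenting the unit carries its whole value at `∅`.
  obtain ⟨p, hp, hp₀⟩ : ∃ p ∈ M, evalFinset ∅ (dimMeasure φ p.1.1 p.1.2) ≠ 0 := by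
    by_contra! h
    have : evalFinset ∅ (M.map fun p => dimMeasure φ p.1.1 p.1.2).sum = 0 := by
      rw [map_multiset_sum, Multiset.map_map]
      refine Multiset.sum_eq_zero fun i hi => ?_
      obtain ⟨p, hp, rfl⟩ := Multiset.mem_map.1 hi
      exact h p hp
    rw [← hsum, hM, evalFinset_unit] at this
    exact one_ne_zero this
  obtain ⟨N, rfl⟩ := Multiset.exists_cons_of_mem hp
  obtain ⟨⟨s, t⟩, hst⟩ := p
  dsimp only at hst hp₀
  rw [Multiset.map_cons, Multiset.sum_cons, hM] at hsum
  have hN₀ : 0 ≤ (N.map fun p => dimMeasure φ p.1.1 p.1.2).sum :=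
    Multiset.sum_nonneg fun g hg => by
      obtain ⟨p, -, rfl⟩ := Multiset.mem_map.1 hg
      exact hf₀ p.2
  set r := (N.map fun p => dimMeasure φ p.1.1 p.1.2).sum with hr
  have hone : ∀ A, evalFinset A (dimMeasure φ s t) + evalFinset A r = 1 := fun A => by
    rw [← map_add, ← hsum, evalFinset_unit]
  have hone₀ : evalFinset ∅ (dimMeasure φ s t) = 1 := by
    have h₁ := hone ∅
    have h₂ := (nonneg_iff.1 hN₀).1 ∅
    have h₃ := (nonneg_iff.1 (hf₀ hst)).1 ∅
    omega
  have hval : ∀ A : Finset Ω, (∀ x ∈ A, x ∉ supp (dimMeasure φ s t)) →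
      evalFinset A (dimMeasure φ s t) = 1 := fun A hA => by
    refine ((supp_spec (dimMeasure φ s t)).apply_eq fun x hx => ?_).trans hone₀
    simpa using fun h => hA x h hx
  have key : ∀ x, x ∉ supp (dimMeasure φ s t) → ∃ w, s ≤ w ∧ w ≤ t ∧
      ((evalFinset ∅ (dimMeasure φ s w) = 0 ∧ evalFinset {x} (dimMeasure φ s w) = 1) ∨
       (evalFinset ∅ (dimMeasure φ s w) = 1 ∧ evalFinset {x} (dimMeasure φ s w) = 0)) := by
    intro x hx
    obtain ⟨α, β, hαβ, hα, hβ⟩ := hμ (Dim.mk L (⟨(s, t), hst⟩ ::ₘ N))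
      ⟨indicator x, indicator_nonneg x⟩ ⟨unit - indicator x, sub_nonneg.2 (indicator_le_unit x)⟩
      (by rw [hc]; exact Subtype.ext (by simp))
    have hmem := mem_splittings_of_mk_eq_add φ hαβ
    have hφα : φ α = indicator x := congrArg Subtype.val hα
    have hφβ : φ β = unit - indicator x := congrArg Subtype.val hβ
    rw [hφα, hφβ, ← Multiset.singleton_add, map_add] at hmem
    obtain ⟨⟨a, b⟩, hab, ⟨a', b'⟩, hab', heq⟩ := hmem
    rw [splittings_singleton] at hab
    obtain ⟨ha', hb', hsum'⟩ := splittings_nonneg_add_eq hf hf₀ N _ hab'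
    simp only [Prod.mk_add_mk, Prod.mk.injEq] at heq
    dsimp only at ha' hb' hsum'
    rw [← hr] at hsum'
    have hrest : ∀ A, evalFinset A (dimMeasure φ s t) = 1 →
        evalFinset A a' = 0 ∧ evalFinset A b' = 0 := fun A hA => by
      have h₁ := hone A
      rw [← hsum', map_add] at h₁
      have h₂ := (nonneg_iff.1 ha').1 A
      have h₃ := (nonneg_iff.1 hb').1 A
      omega
    have hab₀ : ∀ A, evalFinset A (dimMeasure φ s t) = 1 →
        evalFinset A a = (if x ∈ A then 1 else 0) ∧
        evalFinset A b = 1 - if x ∈ A then 1 else 0 := fun A hA => by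
      have h₁ := congrArg (evalFinset A) heq.1
      have h₂ := congrArg (evalFinset A) heq.2
      rw [map_add, (hrest A hA).1, add_zero, evalFinset_indicator] at h₁
      rw [map_add, (hrest A hA).2, add_zero, map_sub, evalFinset_indicator, evalFinset_unit] at h₂
      exact ⟨h₁, h₂⟩
    have h₀ := hab₀ ∅ hone₀
    have h₁ := hab₀ {x} (hval {x} (by simpa using hx))
    exact Splitting.exists_separating hf (fun h => (nonneg_iff.1 (hf₀ h)).1 _)
      (fun h => (nonneg_iff.1 (hf₀ h)).1 _) hab (by simpa using h₀.1) (by simpa using h₁.1)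
      (by simpa using h₀.2) (by simpa using h₁.2)
  have : Nonempty L := ⟨s⟩
  -- Colouring the chain does not control which of the two patterns occurs at `x`.
  choose! w hsw hwt hw using key
  set S := supp (dimMeasure φ s t) with hS
  let X : ℤ → Set Ω := fun i => {x | x ∉ S ∧ evalFinset ∅ (dimMeasure φ s (w x)) = i ∧
    evalFinset {x} (dimMeasure φ s (w x)) = 1 - i}
  have hX : ∀ i, Cardinal.mk (X i) < Cardinal.aleph 2 := fun i => by
    by_contra! h
    refine false_of_separating hf hf₀ h (s := s) (t := t) (w := w) (i := i) (j := 1 - i)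
      (fun A hA => hval A fun x hx => (hA hx).1) (fun x hx => hsw x hx.1)
      (fun x hx => hwt x hx.1) (by omega) (fun x hx => hx.2.1) (fun x hx => hx.2.2)
  have hcover : (Set.univ : Set Ω) ⊆ (S : Set Ω) ∪ (X 0 ∪ X 1) := fun x _ => by
    by_cases hx : x ∈ S
    · exact .inl hx
    · exact .inr ((hw x hx).imp (fun h => ⟨hx, h.1, by simpa using h.2⟩)
        fun h => ⟨hx, h.1, by simpa using h.2⟩)
  have hlt : ∀ {Y Z : Set Ω}, Cardinal.mk Y < Cardinal.aleph 2 → Cardinal.mk Z < Cardinal.aleph 2 →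
      Cardinal.mk ↥(Y ∪ Z) < Cardinal.aleph 2 := fun h h' =>
    (Cardinal.mk_union_le _ _).trans_lt (Cardinal.add_lt_of_lt (Cardinal.aleph0_le_aleph 2) h h')
  have hSlt : Cardinal.mk (S : Set Ω) < Cardinal.aleph 2 :=
    (Cardinal.lt_aleph0_of_finite _).trans_le (Cardinal.aleph0_le_aleph 2)
  have := (Cardinal.mk_le_mk_of_subset hcover).trans_lt (hlt hSlt (hlt (hX 0) (hX 1)))
  rw [Cardinal.mk_univ] at this
  exact this.not_ge hΩ

end cubeGroup

theorem isVHom_of_addEquiv {M N : Type*} [AddCommMonoid M] [AddCommMonoid N] (e : M ≃+ N) :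
    IsVHom (e : M →+ N) := fun c a b h =>
  ⟨e.symm a, e.symm b, e.injective (by simpa using h), by simp, by simp⟩

end LatticeDim

theorem mainTheorem2 (κ : Cardinal.{u}) (hκ : Cardinal.aleph 2 ≤ κ) :
    ∃ (G : Type u) (_ : AddCommGroup G) (_ : PartialOrder G) (_ : IsOrderedAddMonoid G),
      LatticeDim.IsDimensionGroup G ∧
      (∃ e : G, LatticeDim.IsOrderUnit e ∧ LatticeDim.HasIndex e 2) ∧
      Cardinal.mk G = κ ∧
      ∀ (L : Type v) [Lattice L],
        (¬ ∃ μ : LatticeDim.Dim L →+ AddSubmonoid.nonneg G,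
          LatticeDim.IsVHom μ ∧ Function.Surjective μ) ∧
        IsEmpty (AddSubmonoid.nonneg G ≃+ LatticeDim.Dim L) := by
  classical
  have hκ₀ : Cardinal.aleph0 ≤ Cardinal.mk κ.out := by
    rw [Cardinal.mk_out]; exact (Cardinal.aleph0_le_aleph 2).trans hκ
  have : Infinite κ.out := Cardinal.infinite_iff.2 hκ₀
  refine ⟨LatticeDim.cubeGroup κ.out, inferInstance, inferInstance, inferInstance,
    LatticeDim.cubeGroup.isDimensionGroup,
    ⟨LatticeDim.cubeGroup.unit, LatticeDim.cubeGroup.isOrderUnit_unit,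
      LatticeDim.cubeGroup.hasIndex_unit⟩,
    LatticeDim.cubeGroup.mk_eq.trans (Cardinal.mk_out κ), fun L _ => ?_⟩
  have h := LatticeDim.cubeGroup.not_exists_surjective_isVHom (L := L) (Ω := κ.out)
    (hκ.trans_eq (Cardinal.mk_out κ).symm)
  exact ⟨h, ⟨fun e => h ⟨e.symm, LatticeDim.isVHom_of_addEquiv e.symm, e.symm.surjective⟩⟩⟩
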